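/- Let $n,k$ be positive integers. For $\theta\in\mathbb R$ and $\gamma\in\mathbb R^n$ let $P_{\theta,\gamma}$ denote the joint distribution of $X_1,\dots,X_n$ in the model $X_j=\theta+\gamma_j+Z_j$, where $Z_1,\dots,Z_n$ are independent $N(0,1)$ random variables, and let $\|\gamma\|_0$ denote the number of nonzero coordinates of $\gamma$. There exist universal constants $C,c>0$ such that, whenever $1\le k\le \frac n2-\sqrt n$, $$\inf_{\hat\theta}\ \sup_{\theta\in\mathbb R,\ \gamma\in\mathbb R^n,\ \|\gamma\|_0\le k} P_{\theta,\gamma}\left\{\,|\hat\theta-\theta|> C\cdot\frac kn\,\log^{-1/2}\left(1+\frac{k^2(n-2k)^2}{n^3}\right)\right\}\ \ge\ c ,$$ where the infimum runs over all estimators, that is, all measurable functions $\hat\theta=\hat\theta(X_1,\dots,X_n)$ from $\mathbb R^n$ to $\mathbb R$. -/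

import Mathlib

open MeasureTheory ProbabilityTheory

/-- The joint law `P_{θ,γ,σ}` of `(X_1, …, X_n)` in the model `X_j = θ + γ_j + σ Z_j`,
where `Z_1, …, Z_n` are independent standard normal variables. -/
noncomputable def modelLaw {n : ℕ} (θ : ℝ) (γ : Fin n → ℝ) (σ : ℝ) : Measure (Fin n → ℝ) :=
  (Measure.pi fun _ : Fin n => gaussianReal 0 1).map fun z j => θ + γ j + σ * z j

/-! The proof is Le Cam's two-hypothesis method with random contaminations. The coordinates are
drawn i.i.d. from a finite Gaussian mixture whose mixing law has an atom of mass at least `1 - ε` at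
the location, `0` or `d`. With `ε` slightly below `k / n`, at most `k` coordinates leave the atom
with high probability, so a good estimator would distinguish the two mixtures. This is impossible
when `n` times their squared `L²(N(0, 1))` distance is small (`minimax_lower_bound_of_mixtures`).

For a signed measure `s` that squared distance is `∑ s x s y exp (x y)`, which is tiny if `s` has
about `2N` vanishing moments and lives on `|x| ≤ √N / 2`. A divided difference at `-N, …, N`, `τ`
and `1/2`, normalised to `s 0 = 1`, has the form `δ₀ - δ_τ + O(τ)`; rescaling by `1 / (2√N)` gives
separation `τ / (2√N)` and energy `O(τ² exp (-N))` (`exists_weights_energy_le`). Its positive and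
negative parts, damped and completed by a common part, give the mixing laws with `τ ≍ ε`. Damping by
`O(1 - 2ε)` brings in `(n - 2k)²` (`exists_mixing_distributions`).

With `a = k² (n - 2k)² / n³`, the total is of order at most `a exp (-N)`, bounded once `N ≥ log (1 +
a)`; then `d ≍ (k / n) / √(log (1 + a))`. If `k` is at most of order `√n`, the claimed rate is `O(1
/ √n)` and two point masses suffice. -/

/-! ### Gaussian likelihood ratios. -/

/-- The likelihood ratio of `N(a, 1)` with respect to `N(0, 1)`. -/
noncomputable def gaussLR (a z : ℝ) : ℝ := Real.exp (a * z - a ^ 2 / 2)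

lemma gaussLR_pos (a z : ℝ) : 0 < gaussLR a z := Real.exp_pos _

lemma gaussLR_zero (z : ℝ) : gaussLR 0 z = 1 := by simp [gaussLR]

lemma gaussLR_mul (a b z : ℝ) :
    gaussLR a z * gaussLR b z =
      Real.exp (-(a ^ 2 / 2 + b ^ 2 / 2)) * Real.exp ((a + b) * z) := by
  rw [gaussLR, gaussLR, ← Real.exp_add, ← Real.exp_add]
  congr 1; ring

lemma integrable_gaussLR (a : ℝ) : Integrable (gaussLR a) (gaussianReal 0 1) := by
  have h := (integrable_exp_mul_gaussianReal (μ := 0) (v := 1) a).const_mul (Real.exp (-(a ^ 2 / 2)))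
  refine h.congr (Filter.Eventually.of_forall fun z => ?_)
  simp only [gaussLR]
  rw [← Real.exp_add]; congr 1; ring

lemma integrable_gaussLR_mul (a b : ℝ) :
    Integrable (fun z => gaussLR a z * gaussLR b z) (gaussianReal 0 1) := by
  simp_rw [gaussLR_mul]
  exact (integrable_exp_mul_gaussianReal _).const_mul _

/-- The Gaussian moment generating function at `a + b`. This identity turns `L²` distances between
mixtures into finite double sums with kernel `exp (x y)`. -/
lemma integral_gaussLR_mul (a b : ℝ) :
    ∫ z, gaussLR a z * gaussLR b z ∂gaussianReal 0 1 = Real.exp (a * b) := by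
  simp_rw [gaussLR_mul]
  rw [integral_const_mul]
  have h := congrFun (mgf_fun_id_gaussianReal (μ := 0) (v := 1)) (a + b)
  rw [mgf] at h
  rw [h, ← Real.exp_add]
  congr 1; simp; ring

lemma integral_gaussLR (a : ℝ) : ∫ z, gaussLR a z ∂gaussianReal 0 1 = 1 := by
  simpa [gaussLR_zero] using integral_gaussLR_mul a 0

lemma gaussianReal_eq_integral_gaussLR (a : ℝ) {s : Set ℝ} (hs : MeasurableSet s) :
    gaussianReal a 1 s =
      ENNReal.ofReal (∫ z, s.indicator (gaussLR a) z ∂gaussianReal 0 1) := by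
  rw [gaussianReal_apply_eq_integral _ one_ne_zero,
    integral_gaussianReal_eq_integral_smul one_ne_zero, ← integral_indicator hs]
  congr 2
  ext z
  by_cases hz : z ∈ s
  · simp only [hz, Set.indicator_of_mem, smul_eq_mul, gaussianPDFReal, gaussLR]
    rw [mul_assoc (√_)⁻¹, ← Real.exp_add]
    congr 2
    simp; ring
  · simp [hz]

lemma modelLaw_eq_withDensity {n : ℕ} (θ : ℝ) (γ : Fin n → ℝ) :
    modelLaw θ γ 1 = (Measure.pi fun _ : Fin n => gaussianReal 0 1).withDensity
      (fun x => ENNReal.ofReal (∏ j, gaussLR (θ + γ j) (x j))) := by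
  have h1 : modelLaw θ γ 1 = Measure.pi fun j => gaussianReal (θ + γ j) 1 := by
    have hg : ∀ j, (gaussianReal 0 1).map (fun z => θ + γ j + 1 * z)
        = gaussianReal (θ + γ j) 1 := by
      intro j
      simp only [one_mul]
      rw [gaussianReal_map_const_add]; simp
    have h := Measure.pi_map_pi (μ := fun _ : Fin n => gaussianReal 0 1)
      (f := fun j z => θ + γ j + 1 * z) (fun j => by fun_prop)
    simp_rw [hg] at h
    exact h
  rw [h1]
  refine Measure.pi_eq fun s hs => ?_
  rw [withDensity_apply _ (MeasurableSet.univ_pi hs), ← lintegral_indicator (MeasurableSet.univ_pi hs)]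
  have hi : ∀ x : Fin n → ℝ, (Set.univ.pi s).indicator
      (fun x => ENNReal.ofReal (∏ j, gaussLR (θ + γ j) (x j))) x =
      ENNReal.ofReal (∏ j, (s j).indicator (gaussLR (θ + γ j)) (x j)) := by
    intro x
    by_cases hx : x ∈ Set.univ.pi s
    · rw [Set.indicator_of_mem hx]
      congr 1
      refine Finset.prod_congr rfl fun j _ => ?_
      rw [Set.indicator_of_mem (hx j (Set.mem_univ j))]
    · rw [Set.indicator_of_notMem hx]
      simp only [Set.mem_univ_pi, not_forall] at hx
      obtain ⟨j, hj⟩ := hx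
      rw [Finset.prod_eq_zero (Finset.mem_univ j) (Set.indicator_of_notMem hj _)]
      simp
  simp_rw [hi]
  have hnn : ∀ j z, 0 ≤ (s j).indicator (gaussLR (θ + γ j)) z := fun j z =>
    Set.indicator_nonneg (fun z _ => (gaussLR_pos _ z).le) z
  rw [← ofReal_integral_eq_lintegral_ofReal]
  · rw [integral_fintype_prod_eq_prod (fun j => (s j).indicator (gaussLR (θ + γ j))),
      ENNReal.ofReal_prod_of_nonneg fun j _ => integral_nonneg (hnn j)]
    exact Finset.prod_congr rfl fun j _ => (gaussianReal_eq_integral_gaussLR _ (hs j)).symm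
  · exact Integrable.fintype_prod (f := fun j => (s j).indicator (gaussLR (θ + γ j)))
      fun j => (integrable_gaussLR _).indicator (hs j)
  · exact Filter.Eventually.of_forall fun x => Finset.prod_nonneg fun j _ => hnn j _

lemma modelLaw_apply {n : ℕ} (θ : ℝ) (γ : Fin n → ℝ) {A : Set (Fin n → ℝ)} (hA : MeasurableSet A) :
    modelLaw θ γ 1 A = ENNReal.ofReal
      (∫ x in A, ∏ j, gaussLR (θ + γ j) (x j) ∂Measure.pi fun _ : Fin n => gaussianReal 0 1) := by
  rw [modelLaw_eq_withDensity, withDensity_apply _ hA, ofReal_integral_eq_lintegral_ofReal]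
  · exact (Integrable.fintype_prod (f := fun j => gaussLR (θ + γ j))
      fun j => integrable_gaussLR _).integrableOn
  · exact Filter.Eventually.of_forall fun x => Finset.prod_nonneg fun j _ => (gaussLR_pos _ _).le

/-! ### Finite Gaussian mixtures and their `L²` norms. -/

/-- The likelihood ratio, with respect to `N(0, 1)`, of the mixture of the laws `N(x, 1)`, `x ∈ X`,
with weights `p`. -/
noncomputable def mixLR (X : Finset ℝ) (p : ℝ → ℝ) (z : ℝ) : ℝ := ∑ x ∈ X, p x * gaussLR x z

lemma integrable_mixLR (X : Finset ℝ) (p : ℝ → ℝ) : Integrable (mixLR X p) (gaussianReal 0 1) :=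
  integrable_finsetSum _ fun x _ => (integrable_gaussLR x).const_mul _

lemma integral_mixLR (X : Finset ℝ) (p : ℝ → ℝ) :
    ∫ z, mixLR X p z ∂gaussianReal 0 1 = ∑ x ∈ X, p x := by
  simp_rw [mixLR]
  rw [integral_finsetSum _ fun x _ => (integrable_gaussLR x).const_mul _]
  simp_rw [integral_const_mul, integral_gaussLR, mul_one]

lemma mixLR_sq (X : Finset ℝ) (p : ℝ → ℝ) (z : ℝ) :
    mixLR X p z ^ 2 = ∑ x ∈ X, ∑ y ∈ X, p x * p y * (gaussLR x z * gaussLR y z) := by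
  rw [mixLR, pow_two, Finset.sum_mul_sum]
  refine Finset.sum_congr rfl fun x _ => Finset.sum_congr rfl fun y _ => by ring

lemma integrable_mixLR_sq (X : Finset ℝ) (p : ℝ → ℝ) :
    Integrable (fun z => mixLR X p z ^ 2) (gaussianReal 0 1) := by
  simp_rw [mixLR_sq]
  exact integrable_finsetSum _ fun x _ => integrable_finsetSum _ fun y _ =>
    (integrable_gaussLR_mul x y).const_mul _

lemma integral_mixLR_sq (X : Finset ℝ) (p : ℝ → ℝ) :
    ∫ z, mixLR X p z ^ 2 ∂gaussianReal 0 1 =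
      ∑ x ∈ X, ∑ y ∈ X, p x * p y * Real.exp (x * y) := by
  simp_rw [mixLR_sq]
  rw [integral_finsetSum _ fun x _ => integrable_finsetSum _ fun y _ =>
    (integrable_gaussLR_mul x y).const_mul _]
  refine Finset.sum_congr rfl fun x _ => ?_
  rw [integral_finsetSum _ fun y _ => (integrable_gaussLR_mul x y).const_mul _]
  refine Finset.sum_congr rfl fun y _ => ?_
  rw [integral_const_mul, integral_gaussLR_mul]

lemma mixLR_nonneg {X : Finset ℝ} {p : ℝ → ℝ} (hp : ∀ x ∈ X, 0 ≤ p x) (z : ℝ) :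
    0 ≤ mixLR X p z :=
  Finset.sum_nonneg fun x hx => mul_nonneg (hp x hx) (gaussLR_pos x z).le

/-- The atom at `0` contributes a constant, since `gaussLR 0 = 1`. An atom of mass at least `1/2`
thus bounds the density away from zero, so that the plain `L²` distance controls the chi-square
divergence. -/
lemma le_mixLR {X : Finset ℝ} {p : ℝ → ℝ} (hp : ∀ x ∈ X, 0 ≤ p x) (h0 : (0 : ℝ) ∈ X) (z : ℝ) :
    p 0 ≤ mixLR X p z := by
  have := Finset.single_le_sum (f := fun x => p x * gaussLR x z)
    (fun x hx => mul_nonneg (hp x hx) (gaussLR_pos x z).le) h0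
  simpa [gaussLR_zero, mixLR] using this

lemma prod_mixLR {n : ℕ} (X : Finset ℝ) (p : ℝ → ℝ) (x : Fin n → ℝ) :
    ∏ j, mixLR X p (x j) = ∑ b ∈ Fintype.piFinset (fun _ : Fin n => X),
      (∏ j, p (b j)) * ∏ j, gaussLR (b j) (x j) := by
  simp_rw [mixLR, Finset.prod_univ_sum, Finset.prod_mul_distrib]

/-! ### Le Cam's method with sparse mixtures. -/

/-- A lower bound on the sum of the errors of a test between two product measures, in terms of
the `L²` distance of the marginal densities. -/
lemma half_le_setIntegral_prod_add {n : ℕ} {μ : Measure ℝ} [SigmaFinite μ] {u₀ u₁ : ℝ → ℝ}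
    (h₀ : Integrable u₀ μ) (h₁ : Integrable u₁ μ) (h₂ : Integrable (fun z => (u₁ z - u₀ z) ^ 2) μ)
    (hu₀ : ∀ z, 1 / 2 ≤ u₀ z) (hu₁ : ∀ z, 0 ≤ u₁ z) (hi₀ : ∫ z, u₀ z ∂μ = 1)
    (hi₁ : ∫ z, u₁ z ∂μ = 1) (hχ : n * ∫ z, (u₁ z - u₀ z) ^ 2 ∂μ ≤ 1 / 10)
    {A₀ A₁ : Set (Fin n → ℝ)} (hA₀ : MeasurableSet A₀) (hA₁ : MeasurableSet A₁)
    (hA : A₀ ∪ A₁ = Set.univ) :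
    1 / 2 ≤ (∫ x in A₀, ∏ j, u₀ (x j) ∂Measure.pi fun _ : Fin n => μ) +
      ∫ x in A₁, ∏ j, u₁ (x j) ∂Measure.pi fun _ : Fin n => μ := by
  set χ := ∫ z, (u₁ z - u₀ z) ^ 2 ∂μ with hχdef
  have hχ0 : 0 ≤ χ := integral_nonneg fun z => sq_nonneg _
  -- `w` dominates `u₁² / u₀ = (u₁ - u₀)² / u₀ + 2 u₁ - u₀` because `u₀ ≥ 1/2`. Its integral is `1 +
  -- 2χ`, so the second moment of the product likelihood ratio is at most `exp (2nχ)`.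
  set w : ℝ → ℝ := fun z => 2 * (u₁ z - u₀ z) ^ 2 + (2 * u₁ z - u₀ z) with hw
  have hwi : Integrable w μ := (h₂.const_mul 2).add ((h₁.const_mul 2).sub h₀)
  have hwint : ∫ z, w z ∂μ = 1 + 2 * χ := by
    simp only [hw]
    have h3 : Integrable (fun z => 2 * u₁ z - u₀ z) μ := (h₁.const_mul 2).sub h₀
    rw [integral_add (h₂.const_mul 2) h3, integral_sub (h₁.const_mul 2) h₀, integral_const_mul, integral_const_mul, hi₀, hi₁]
    ring
  have hP := Integrable.fintype_prod (ι := Fin n) (f := fun _ => u₀) (μ := fun _ => μ) fun _ => h₀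
  have hQ := Integrable.fintype_prod (ι := Fin n) (f := fun _ => u₁) (μ := fun _ => μ) fun _ => h₁
  have hW := Integrable.fintype_prod (ι := Fin n) (f := fun _ => w) (μ := fun _ => μ) fun _ => hwi
  have hWint : ∫ x, ∏ j, w (x j) ∂Measure.pi (fun _ : Fin n => μ) ≤ 5 / 4 := by
    rw [integral_fintype_prod_eq_pow, hwint, Fintype.card_fin]
    have h1 : (1 + 2 * χ) ^ n ≤ Real.exp (2 * (n * χ)) := by
      rw [show 2 * (n * χ) = n * (2 * χ) by ring, Real.exp_nat_mul]
      refine pow_le_pow_left₀ (by positivity) ?_ n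
      linarith [Real.add_one_le_exp (2 * χ)]
    have h2 : Real.exp (2 * (n * χ)) ≤ 5 / 4 := by
      have h3 := Real.one_sub_le_exp_neg (2 * (n * χ))
      rw [Real.exp_neg] at h3
      have h4 : 4 / 5 ≤ (Real.exp (2 * (n * χ)))⁻¹ := by linarith
      rw [le_inv_comm₀ (by norm_num) (Real.exp_pos _)] at h4
      linarith
    exact h1.trans h2
  rw [← integral_indicator hA₀, ← integral_indicator hA₁,
    ← integral_add (hP.indicator hA₀) (hQ.indicator hA₁)]
  have hkey : ∫ x, (2 * ∏ j, u₁ (x j)) - (∏ j, u₀ (x j)) / 4 - ∏ j, w (x j)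
      ∂Measure.pi (fun _ : Fin n => μ) = 2 - 1 / 4 - ∫ x, ∏ j, w (x j)
      ∂Measure.pi (fun _ : Fin n => μ) := by
    have h3 : Integrable (fun x : Fin n → ℝ => 2 * ∏ j, u₁ (x j) - (∏ j, u₀ (x j)) / 4)
        (Measure.pi fun _ => μ) := (hQ.const_mul 2).sub (hP.div_const 4)
    rw [integral_sub h3 hW,
      integral_sub (hQ.const_mul 2) (hP.div_const 4), integral_const_mul, integral_div,
      integral_fintype_prod_eq_pow, integral_fintype_prod_eq_pow, hi₀, hi₁]
    simp
  refine le_trans (by linarith) (hkey.symm.le.trans ?_)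
  refine integral_mono (((hQ.const_mul 2).sub (hP.div_const 4)).sub hW)
    ((hP.indicator hA₀).add (hQ.indicator hA₁)) fun x => ?_
  have hPx : 0 < ∏ j, u₀ (x j) := Finset.prod_pos fun j _ => by linarith [hu₀ (x j)]
  have hQx : 0 ≤ ∏ j, u₁ (x j) := Finset.prod_nonneg fun j _ => hu₁ _
  have hWx : (∏ j, u₁ (x j)) ^ 2 / ∏ j, u₀ (x j) ≤ ∏ j, w (x j) := by
    rw [← Finset.prod_pow, ← Finset.prod_div_distrib]
    refine Finset.prod_le_prod (fun j _ => div_nonneg (sq_nonneg _) (by linarith [hu₀ (x j)]))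
      fun j _ => ?_
    have := hu₀ (x j)
    rw [div_le_iff₀ (by linarith)]
    simp only [hw]
    nlinarith [mul_nonneg (sq_nonneg (u₁ (x j) - u₀ (x j))) (by linarith : 0 ≤ 2 * u₀ (x j) - 1)]
  set P := ∏ j, u₀ (x j)
  set Q := ∏ j, u₁ (x j)
  -- The next two bounds place `2Q - P/4 - Q²/P` below both `P` and `Q`. Its integral is at least `2
  -- - 1/4 - 5/4 = 1/2`, and the two events cover the space.
  have hb₀ : 2 * Q - P / 4 - Q ^ 2 / P ≤ P := by
    have : 0 ≤ (P - Q) ^ 2 / P := by positivity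
    have h5 : (P - Q) ^ 2 / P = P - 2 * Q + Q ^ 2 / P := by field_simp; ring
    linarith
  have hb₁ : 2 * Q - P / 4 - Q ^ 2 / P ≤ Q := by
    have : 0 ≤ (P / 2 - Q) ^ 2 / P := by positivity
    have h5 : (P / 2 - Q) ^ 2 / P = P / 4 - Q + Q ^ 2 / P := by field_simp; ring
    linarith
  have hi0 : 0 ≤ A₀.indicator (fun x => ∏ j, u₀ (x j)) x :=
    Set.indicator_nonneg (fun y _ => Finset.prod_nonneg fun j _ => by linarith [hu₀ (y j)]) x
  have hi1 : 0 ≤ A₁.indicator (fun x => ∏ j, u₁ (x j)) x :=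
    Set.indicator_nonneg (fun y _ => Finset.prod_nonneg fun j _ => hu₁ _) x
  have hx : x ∈ A₀ ∪ A₁ := hA ▸ Set.mem_univ x
  rcases hx with hx | hx
  · have : A₀.indicator (fun x => ∏ j, u₀ (x j)) x = P := Set.indicator_of_mem hx _
    dsimp only
    linarith
  · have : A₁.indicator (fun x => ∏ j, u₁ (x j)) x = Q := Set.indicator_of_mem hx _
    dsimp only
    linarith

/-- A Chernoff bound for the number of coordinates that differ from `θ` under a product law. -/
lemma sum_prod_hammingNorm_sub_le {n k : ℕ} {X : Finset ℝ} {p : ℝ → ℝ} {θ e v : ℝ}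
    (hp : ∀ x ∈ X, 0 ≤ p x) (hsum : ∑ x ∈ X, p x = 1) (hθ : θ ∈ X) (he : 1 - e ≤ p θ)
    (hv : 0 ≤ v) :
    ∑ b ∈ (Fintype.piFinset (fun _ : Fin n => X)).filter
        (fun b => k < hammingNorm fun j => b j - θ), ∏ j, p (b j) ≤
      Real.exp (n * e * (Real.exp v - 1) - v * k) := by
  have hev : 1 ≤ Real.exp v := Real.one_le_exp hv
  have h1 : ∀ b : Fin n → ℝ, (∏ j, if b j = θ then 1 else Real.exp v) =
      Real.exp (v * (hammingNorm fun j => b j - θ)) := by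
    intro b
    rw [Finset.prod_ite, Finset.prod_const_one, one_mul, Finset.prod_const, ← Real.exp_nat_mul,
      hammingNorm, mul_comm]
    simp_rw [ne_eq, sub_eq_zero]
  have hone : ∑ x ∈ X, p x * (if x = θ then 1 else Real.exp v) ≤ Real.exp (e * (Real.exp v - 1)) := by
    have h2 : ∑ x ∈ X, p x * (if x = θ then 1 else Real.exp v) =
        ∑ x ∈ X, (p x * Real.exp v - if x = θ then p x * (Real.exp v - 1) else 0) := by
      refine Finset.sum_congr rfl fun x _ => ?_
      split_ifs <;> ring
    rw [h2, Finset.sum_sub_distrib, ← Finset.sum_mul, hsum, Finset.sum_ite_eq' X θ, if_pos hθ]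
    have h3 := Real.add_one_le_exp (e * (Real.exp v - 1))
    nlinarith
  have hone0 : 0 ≤ ∑ x ∈ X, p x * (if x = θ then 1 else Real.exp v) :=
    Finset.sum_nonneg fun x hx => mul_nonneg (hp x hx) (by split_ifs <;> positivity)
  have hb0 : ∀ b ∈ Fintype.piFinset (fun _ : Fin n => X), 0 ≤ ∏ j, p (b j) := fun b hb =>
    Finset.prod_nonneg fun j _ => hp _ (Fintype.mem_piFinset.1 hb j)
  -- Markov's inequality for `exp (v * hammingNorm)`, whose expectation factors over the
  -- coordinates.
  calc _ ≤ ∑ b ∈ (Fintype.piFinset (fun _ : Fin n => X)).filter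
        (fun b => k < hammingNorm fun j => b j - θ), Real.exp (-(v * k)) *
          ∏ j, (p (b j) * if b j = θ then 1 else Real.exp v) := by
        refine Finset.sum_le_sum fun b hb => ?_
        rw [Finset.mem_filter] at hb
        rw [Finset.prod_mul_distrib, h1, mul_left_comm, ← Real.exp_add]
        refine le_mul_of_one_le_right (hb0 b hb.1) (Real.one_le_exp ?_)
        have : (k : ℝ) ≤ (hammingNorm fun j => b j - θ : ℕ) := by exact_mod_cast hb.2.le
        nlinarith
    _ ≤ ∑ b ∈ Fintype.piFinset (fun _ : Fin n => X), Real.exp (-(v * k)) *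
          ∏ j, (p (b j) * if b j = θ then 1 else Real.exp v) := by
        refine Finset.sum_le_sum_of_subset_of_nonneg (Finset.filter_subset _ _) fun b hb _ => ?_
        refine mul_nonneg (Real.exp_pos _).le (Finset.prod_nonneg fun j _ =>
          mul_nonneg (hp _ (Fintype.mem_piFinset.1 hb j)) (by split_ifs <;> positivity))
    _ = Real.exp (-(v * k)) * (∑ x ∈ X, p x * (if x = θ then 1 else Real.exp v)) ^ n := by
        rw [← Finset.mul_sum, ← Finset.prod_univ_sum (fun _ : Fin n => X)
          (fun _ x => p x * if x = θ then 1 else Real.exp v)]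
        simp
    _ ≤ Real.exp (-(v * k)) * Real.exp (e * (Real.exp v - 1)) ^ n := by gcongr
    _ = _ := by
        rw [← Real.exp_nat_mul, ← Real.exp_add]; congr 1; ring

/-- A bound on all sparse probabilities of an event transfers to a mixture up to the probability
that the mixture is not sparse. -/
lemma setIntegral_prod_mixLR_le {n k : ℕ} {X : Finset ℝ} {p : ℝ → ℝ} {θ S : ℝ} (hS : 0 ≤ S)
    (hp : ∀ x ∈ X, 0 ≤ p x) (hsum : ∑ x ∈ X, p x = 1) {A : Set (Fin n → ℝ)} (hA : MeasurableSet A)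
    (hbound : ∀ γ : Fin n → ℝ, hammingNorm γ ≤ k → modelLaw θ γ 1 A ≤ ENNReal.ofReal S) :
    ∫ x in A, ∏ j, mixLR X p (x j) ∂Measure.pi (fun _ : Fin n => gaussianReal 0 1) ≤
      S + ∑ b ∈ (Fintype.piFinset (fun _ : Fin n => X)).filter
        (fun b => k < hammingNorm fun j => b j - θ), ∏ j, p (b j) := by
  have hint : ∀ b : Fin n → ℝ, Integrable (fun x : Fin n → ℝ => ∏ j, gaussLR (b j) (x j))
      (Measure.pi fun _ : Fin n => gaussianReal 0 1) := fun b =>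
    Integrable.fintype_prod (f := fun j => gaussLR (b j)) fun j => integrable_gaussLR _
  have hnn : ∀ b x : Fin n → ℝ, 0 ≤ ∏ j, gaussLR (b j) (x j) := fun b x =>
    Finset.prod_nonneg fun j _ => (gaussLR_pos _ _).le
  have hb0 : ∀ b ∈ Fintype.piFinset (fun _ : Fin n => X), 0 ≤ ∏ j, p (b j) := fun b hb =>
    Finset.prod_nonneg fun j _ => hp _ (Fintype.mem_piFinset.1 hb j)
  simp_rw [prod_mixLR]
  rw [integral_finsetSum _ fun b _ => ((hint b).integrableOn).const_mul _]
  simp_rw [integral_const_mul]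
  have htot : ∑ b ∈ Fintype.piFinset (fun _ : Fin n => X), ∏ j, p (b j) = 1 := by
    rw [← Finset.prod_univ_sum (fun _ : Fin n => X) (fun _ x => p x)]
    simp [hsum]
  have hle1 : ∀ b : Fin n → ℝ, ∫ x in A, ∏ j, gaussLR (b j) (x j)
      ∂Measure.pi (fun _ : Fin n => gaussianReal 0 1) ≤ 1 := by
    intro b
    refine (setIntegral_le_integral (hint b) (Filter.Eventually.of_forall fun x => hnn b x)).trans ?_
    rw [integral_fintype_prod_eq_prod (fun j => gaussLR (b j))]
    simp [integral_gaussLR]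
  have hleS : ∀ b : Fin n → ℝ, (hammingNorm fun j => b j - θ) ≤ k →
      ∫ x in A, ∏ j, gaussLR (b j) (x j)
        ∂Measure.pi (fun _ : Fin n => gaussianReal 0 1) ≤ S := by
    intro b hb
    have h := hbound _ hb
    rw [modelLaw_apply _ _ hA, ENNReal.ofReal_le_ofReal_iff hS] at h
    simpa using h
  rw [← Finset.sum_filter_add_sum_filter_not (Fintype.piFinset fun _ : Fin n => X)
    (fun b => k < hammingNorm fun j => b j - θ), add_comm]
  refine add_le_add ?_ (Finset.sum_le_sum fun b hb =>
    mul_le_of_le_one_right (hb0 b (Finset.mem_filter.1 hb).1) (hle1 b))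
  calc _ ≤ ∑ b ∈ (Fintype.piFinset fun _ : Fin n => X).filter
        (fun b => ¬ k < hammingNorm fun j => b j - θ), (∏ j, p (b j)) * S := by
        refine Finset.sum_le_sum fun b hb => ?_
        rw [Finset.mem_filter, not_lt] at hb
        exact mul_le_mul_of_nonneg_left (hleS b hb.2) (hb0 b hb.1)
    _ ≤ ∑ b ∈ Fintype.piFinset fun _ : Fin n => X, (∏ j, p (b j)) * S :=
        Finset.sum_le_sum_of_subset_of_nonneg (Finset.filter_subset _ _) fun b hb _ =>
          mul_nonneg (hb0 b hb) hS
    _ = S := by rw [← Finset.sum_mul, htot, one_mul]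

/-- Le Cam's method with two fuzzy hypotheses: a pair of mixing distributions, each putting mass at
least `1 - e` on its location, whose Gaussian mixtures are indistinguishable from `n` observations,
gives a lower bound on the minimax risk. -/
theorem minimax_lower_bound_of_mixtures {n k : ℕ} {X : Finset ℝ} {p₀ p₁ : ℝ → ℝ} {d t e v : ℝ}
    (hp₀ : ∀ x ∈ X, 0 ≤ p₀ x) (hp₁ : ∀ x ∈ X, 0 ≤ p₁ x)
    (hsum₀ : ∑ x ∈ X, p₀ x = 1) (hsum₁ : ∑ x ∈ X, p₁ x = 1)
    (h0 : 0 ∈ X) (hd : d ∈ X) (he₀ : 1 - e ≤ p₀ 0) (he₁ : 1 - e ≤ p₁ d) (he : e ≤ 1 / 2)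
    (hv : 0 ≤ v) (htail : Real.exp (n * e * (Real.exp v - 1) - v * k) ≤ 1 / 20)
    (hχ : n * ∑ x ∈ X, ∑ y ∈ X, (p₀ x - p₁ x) * (p₀ y - p₁ y) * Real.exp (x * y) ≤ 1 / 10)
    (htd : 2 * t < d) {est : (Fin n → ℝ) → ℝ} (hest : Measurable est) :
    ENNReal.ofReal (1 / 10) ≤ ⨆ (θ : ℝ) (γ : Fin n → ℝ) (_ : hammingNorm γ ≤ k),
      modelLaw θ γ 1 {x | t < |est x - θ|} := by
  by_contra! hlt
  have hle : ∀ θ : ℝ, ∀ γ : Fin n → ℝ, hammingNorm γ ≤ k →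
      modelLaw θ γ 1 {x | t < |est x - θ|} ≤ ENNReal.ofReal (1 / 10) := by
    intro θ γ hγ
    refine le_trans ?_ hlt.le
    exact le_iSup_of_le θ (le_iSup_of_le γ (le_iSup_of_le hγ le_rfl))
  have hm : ∀ θ : ℝ, MeasurableSet {x | t < |est x - θ|} := fun θ =>
    measurableSet_lt measurable_const (hest.sub_const θ).abs
  have ha₀ := setIntegral_prod_mixLR_le (by norm_num) hp₀ hsum₀ (hm 0) (hle 0)
  have ha₁ := setIntegral_prod_mixLR_le (by norm_num) hp₁ hsum₁ (hm d) (hle d)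
  have hb₀ := sum_prod_hammingNorm_sub_le (n := n) (k := k) hp₀ hsum₀ h0 he₀ hv
  have hb₁ := sum_prod_hammingNorm_sub_le (n := n) (k := k) hp₁ hsum₁ hd he₁ hv
  have hsq : ∀ z, (mixLR X p₁ z - mixLR X p₀ z) ^ 2 = mixLR X (fun x => p₀ x - p₁ x) z ^ 2 := by
    intro z
    have : mixLR X (fun x => p₀ x - p₁ x) z = mixLR X p₀ z - mixLR X p₁ z := by
      simp only [mixLR, sub_mul, Finset.sum_sub_distrib]
    rw [this]; ring
  have hc := half_le_setIntegral_prod_add (n := n) (integrable_mixLR X p₀) (integrable_mixLR X p₁)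
    (by simp_rw [hsq]; exact integrable_mixLR_sq _ _)
    (fun z => le_trans (by linarith) (le_mixLR hp₀ h0 z)) (mixLR_nonneg hp₁)
    (by rw [integral_mixLR, hsum₀]) (by rw [integral_mixLR, hsum₁])
    (by simp_rw [hsq]; rwa [integral_mixLR_sq]) (hm 0) (hm d) (by
      ext x
      simp only [Set.mem_union, Set.mem_ofPred_eq, Set.mem_univ, iff_true]
      by_contra! h
      have h1 := abs_le.1 h.1
      have h2 := abs_le.1 h.2
      linarith [h1.2, h2.1])
  -- The two errors sum to at least `1/2`, but to at most `2 (1/10 + 1/20)` by the assumed risk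
  -- bound and the two Chernoff tails.
  linarith

/-! ### Exponential energy of a signed measure with vanishing moments. -/

section

open Finset

/-- The series are compared termwise, using `n! m! ≤ (m + n)!`. -/
lemma Real.exp_sub_sum_le {t : ℝ} (ht : 0 ≤ t) (n : ℕ) :
    Real.exp t - ∑ m ∈ range n, t ^ m / m.factorial ≤ t ^ n / n.factorial * Real.exp t := by
  have hs : HasSum (fun m : ℕ => t ^ m / m.factorial) (Real.exp t) := by
    rw [Real.exp_eq_exp_ℝ]; exact NormedSpace.expSeries_div_hasSum_exp t
  have h1 := (hasSum_nat_add_iff' n).2 hs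
  have h2 := hs.mul_left (t ^ n / n.factorial)
  refine hasSum_le (fun m => ?_) h1 h2
  rw [div_mul_div_comm, ← pow_add, add_comm n m]
  have : (n.factorial * m.factorial : ℝ) ≤ (m + n).factorial := by
    rw [mul_comm]; exact_mod_cast Nat.le_of_dvd (Nat.factorial_pos _) (Nat.factorial_mul_factorial_dvd_factorial_add m n)
  gcongr

lemma Real.abs_exp_sub_sum_le (t : ℝ) (n : ℕ) :
    |Real.exp t - ∑ m ∈ range n, t ^ m / m.factorial| ≤ |t| ^ n / n.factorial * Real.exp |t| := by
  have h := Complex.norm_exp_sub_sum_le_exp_norm_sub_sum (t : ℂ) n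
  have h2 := Real.exp_sub_sum_le (abs_nonneg t) n
  rw [Complex.norm_real, Real.norm_eq_abs] at h
  refine le_trans (le_of_eq ?_) (h.trans h2)
  rw [← Real.norm_eq_abs, ← Complex.norm_real]
  push_cast; rfl

/-- If `s` annihilates the polynomials of degree less than `M`, then the exponential energy
of `s` is controlled by its tail moments. -/
lemma sum_mul_exp_le_of_moments_eq_zero {X : Finset ℝ} {s : ℝ → ℝ} {M : ℕ} {B : ℝ} (hM : 1 ≤ M)
    (hX : ∀ x ∈ X, |x| ≤ B) (hs : ∀ m < M, ∑ x ∈ X, s x * x ^ m = 0) :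
    ∑ x ∈ X, ∑ y ∈ X, s x * s y * Real.exp (x * y) ≤
      (∑ x ∈ X, |s x| * |x|) ^ 2 * ((B ^ 2) ^ (M - 1) * Real.exp (B ^ 2) / M.factorial) := by
  have h0 : ∑ x ∈ X, ∑ y ∈ X, s x * s y * ∑ m ∈ range M, (x * y) ^ m / m.factorial = 0 := by
    refine sum_eq_zero fun x _ => ?_
    simp_rw [mul_sum]
    rw [sum_comm]
    refine sum_eq_zero fun m hm => ?_
    have : ∀ y ∈ X, s x * s y * ((x * y) ^ m / m.factorial) =
        (s x * x ^ m / m.factorial) * (s y * y ^ m) := fun y _ => by rw [mul_pow]; ring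
    rw [sum_congr rfl this, ← mul_sum, hs m (mem_range.1 hm), mul_zero]
  have h1 : ∑ x ∈ X, ∑ y ∈ X, s x * s y * Real.exp (x * y) =
      ∑ x ∈ X, ∑ y ∈ X, s x * s y *
        (Real.exp (x * y) - ∑ m ∈ range M, (x * y) ^ m / m.factorial) := by
    simp_rw [mul_sub, sum_sub_distrib]
    rw [h0, sub_zero]
  rw [h1, pow_two (∑ x ∈ X, |s x| * |x|), sum_mul_sum, sum_mul]
  refine sum_le_sum fun x hx => ?_
  rw [sum_mul]
  refine sum_le_sum fun y hy => ?_
  have hB : 0 ≤ B := (abs_nonneg x).trans (hX x hx)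
  have hxy : |x * y| ≤ B ^ 2 := by
    rw [abs_mul, pow_two]
    exact mul_le_mul (hX x hx) (hX y hy) (abs_nonneg _) hB
  calc _ ≤ |s x * s y * (Real.exp (x * y) - ∑ m ∈ range M, (x * y) ^ m / m.factorial)| :=
        le_abs_self _
    _ = |s x| * |s y| * |Real.exp (x * y) - ∑ m ∈ range M, (x * y) ^ m / m.factorial| := by
        rw [abs_mul, abs_mul]
    _ ≤ |s x| * |s y| * (|x * y| ^ M / M.factorial * Real.exp |x * y|) := by
        gcongr; exact Real.abs_exp_sub_sum_le _ _
    -- One factor `|x y|` is split off, so that the first absolute moment of `s` appears instead of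
    -- its total mass. An atom at `0` then costs nothing, which later yields the factor `τ²`.
    _ = |s x| * |s y| * (|x * y| * |x * y| ^ (M - 1) / M.factorial * Real.exp |x * y|) := by
        rw [← pow_succ', Nat.sub_add_cancel hM]
    _ ≤ |s x| * |s y| * (|x * y| * (B ^ 2) ^ (M - 1) / M.factorial * Real.exp (B ^ 2)) := by
        gcongr
    _ = _ := by rw [abs_mul x y]; ring

end

/-! ### Products of differences of equispaced nodes. -/

section

open Finset

/-- The equispaced nodes `-N, …, N`. -/
noncomputable def latticeNodes (N : ℕ) : Finset ℝ :=
  (range (2 * N + 1)).image fun j : ℕ => (j : ℝ) - N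

lemma latticeNode_injective (N : ℕ) : Function.Injective fun j : ℕ => (j : ℝ) - N :=
  fun a b h => by simpa using h

lemma prod_range_erase_abs_sub {M i : ℕ} (hi : i ≤ M) :
    ∏ j ∈ (range (M + 1)).erase i, |(i : ℝ) - j| = i.factorial * (M - i).factorial := by
  have h1 : (range (M + 1)).erase i = range i ∪ Ico (i + 1) (M + 1) := by
    ext j; simp only [mem_erase, mem_range, mem_union, mem_Ico]; omega
  have h2 : Disjoint (range i) (Ico (i + 1) (M + 1)) := by
    rw [disjoint_left]; intro j; simp only [mem_range, mem_Ico]; omega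
  rw [h1, prod_union h2]
  congr 1
  · rw [← prod_range_reflect, ← prod_range_add_one_eq_factorial]
    push_cast
    refine prod_congr rfl fun j hj => ?_
    rw [mem_range] at hj
    rw [Nat.cast_sub (by omega), Nat.cast_sub (by omega), abs_of_nonneg]
    · push_cast; ring
    · push_cast
      have : (j : ℝ) + 1 ≤ i := by exact_mod_cast hj
      linarith
  · rw [prod_Ico_eq_prod_range, ← prod_range_add_one_eq_factorial]
    push_cast
    refine prod_congr rfl fun j _ => ?_
    rw [abs_sub_comm, abs_of_nonneg]
    · ring
    · have : (0 : ℝ) ≤ j := j.cast_nonneg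
      linarith

/-- Equivalent to the central binomial coefficient being the largest in its row. -/
lemma factorial_sq_le {N i : ℕ} (hi : i ≤ 2 * N) :
    (N.factorial : ℝ) ^ 2 ≤ i.factorial * (2 * N - i).factorial := by
  have h1 := Nat.choose_mul_factorial_mul_factorial hi
  have h2 := Nat.choose_mul_factorial_mul_factorial (show N ≤ 2 * N by omega)
  have h3 := Nat.choose_le_centralBinom i N
  rw [Nat.centralBinom_eq_two_mul_choose] at h3
  rw [show 2 * N - N = N by omega] at h2
  have hpos := Nat.choose_pos (show N ≤ 2 * N by omega)
  have : N.factorial * N.factorial ≤ i.factorial * (2 * N - i).factorial := by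
    refine Nat.le_of_mul_le_mul_left ?_ hpos
    calc (2 * N).choose N * (N.factorial * N.factorial) = (2 * N).factorial := by
          rw [← h2]; ring
      _ = (2 * N).choose i * (i.factorial * (2 * N - i).factorial) := by rw [← h1]; ring
      _ ≤ _ := Nat.mul_le_mul_right _ h3
  rw [pow_two]; exact_mod_cast this

lemma prod_latticeNodes_erase {N i : ℕ} (hi : i ≤ 2 * N) :
    ∏ z ∈ (latticeNodes N).erase ((i : ℝ) - N), |((i : ℝ) - N) - z| =
      i.factorial * (2 * N - i).factorial := by
  rw [latticeNodes, ← image_erase (latticeNode_injective N) _ i,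
    prod_image (latticeNode_injective N).injOn, ← prod_range_erase_abs_sub hi]
  refine prod_congr rfl fun j _ => ?_
  congr 1; ring

lemma factorial_sq_le_prod_latticeNodes_half (N : ℕ) :
    (N.factorial : ℝ) ^ 2 / 4 ≤ ∏ z ∈ latticeNodes N, |1 / 2 - z| := by
  rw [latticeNodes, prod_image (latticeNode_injective N).injOn]
  -- Induction multiplies the product by `(N + 1/2)(N + 3/2)`, slightly less than `(N + 1)²`. The
  -- extra factor, decreasing to `1`, absorbs the loss.
  have key : (N.factorial : ℝ) ^ 2 / 4 * ((2 * N + 2) / (2 * N + 1)) ≤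
      ∏ j ∈ range (2 * N + 1), |1 / 2 - ((j : ℝ) - N)| := by
    induction N with
    | zero => norm_num
    | succ N ih =>
      rw [show 2 * (N + 1) + 1 = (2 * N + 1 + 1) + 1 by ring, prod_range_succ, prod_range_succ']
      have h1 : ∏ j ∈ range (2 * N + 1), |1 / 2 - (((j + 1 : ℕ) : ℝ) - ((N + 1 : ℕ) : ℝ))| =
          ∏ j ∈ range (2 * N + 1), |1 / 2 - ((j : ℝ) - N)| :=
        prod_congr rfl fun j _ => by push_cast; congr 1; ring
      rw [h1]
      have h2 : |1 / 2 - (((0 : ℕ) : ℝ) - ((N + 1 : ℕ) : ℝ))| = N + 3 / 2 := by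
        rw [abs_of_nonneg] <;> push_cast
        · ring
        · have : (0 : ℝ) ≤ N := N.cast_nonneg
          linarith
      have h3 : |1 / 2 - (((2 * N + 1 + 1 : ℕ) : ℝ) - ((N + 1 : ℕ) : ℝ))| = N + 1 / 2 := by
        rw [abs_sub_comm, abs_of_nonneg] <;> push_cast
        · ring
        · have : (0 : ℝ) ≤ N := N.cast_nonneg
          linarith
      rw [h2, h3, mul_assoc]
      have hN : (0 : ℝ) ≤ N := N.cast_nonneg
      refine le_trans ?_ (mul_le_mul_of_nonneg_right ih (by positivity))
      rw [Nat.factorial_succ]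
      push_cast
      have h4 : 2 * ((N : ℝ) + 1) + 2 = 2 * N + 4 := by ring
      have h5 : 2 * ((N : ℝ) + 1) + 1 = 2 * N + 3 := by ring
      rw [h4, h5]
      have h6 : ((N : ℝ) + 1) ^ 2 * ((2 * N + 4) / (2 * N + 3)) ≤
          (2 * N + 2) / (2 * N + 1) * ((N + 3 / 2) * (N + 1 / 2)) := by
        rw [div_mul_eq_mul_div, ← mul_div_assoc, div_le_div_iff₀ (by positivity) (by positivity)]
        nlinarith [pow_nonneg hN 2, pow_nonneg hN 3]
      have h7 : (0 : ℝ) ≤ (N.factorial : ℝ) ^ 2 := by positivity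
      nlinarith
  refine le_trans (le_mul_of_one_le_right (by positivity) ?_) key
  rw [le_div_iff₀ (by positivity)]; linarith

lemma sum_latticeNodes_inv_sq_le (N : ℕ) (hN : 1 ≤ N) : ∑ z ∈ latticeNodes N, 1 / z ^ 2 ≤ 4 := by
  rw [latticeNodes, sum_image (latticeNode_injective N).injOn]
  -- The node `0` contributes `1 / 0 = 0`. The term `-2 / N` makes the induction telescope.
  have key : ∑ j ∈ range (2 * N + 1), 1 / ((j : ℝ) - N) ^ 2 ≤ 4 - 2 / (N : ℝ) := by
    induction N, hN using Nat.le_induction with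
    | base => norm_num [sum_range_succ]
    | succ N hN ih =>
      rw [show 2 * (N + 1) + 1 = (2 * N + 1 + 1) + 1 by ring, sum_range_succ, sum_range_succ']
      have h1 : ∑ j ∈ range (2 * N + 1), 1 / (((j + 1 : ℕ) : ℝ) - ((N + 1 : ℕ) : ℝ)) ^ 2 =
          ∑ j ∈ range (2 * N + 1), 1 / ((j : ℝ) - N) ^ 2 :=
        sum_congr rfl fun j _ => by push_cast; congr 2; ring
      rw [h1]
      have hN0 : (0 : ℝ) < N := by exact_mod_cast hN
      push_cast
      have h2 : (2 * (N : ℝ) + 2 - (N + 1)) ^ 2 = (N + 1) ^ 2 := by ring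
      have h3 : ((0 : ℝ) - (N + 1)) ^ 2 = (N + 1) ^ 2 := by ring
      rw [h2, h3]
      have h4 : 2 / ((N : ℝ) + 1) ^ 2 ≤ 2 / N - 2 / (N + 1) := by
        rw [div_sub_div _ _ hN0.ne' (by positivity), div_le_div_iff₀ (by positivity) (by positivity)]
        nlinarith
      have h5 : 2 / ((N : ℝ) + 1) ^ 2 = 1 / ((N : ℝ) + 1) ^ 2 + 1 / ((N : ℝ) + 1) ^ 2 := by ring
      linarith
  refine key.trans ?_
  have : (0 : ℝ) ≤ 2 / (N : ℝ) := by positivity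
  linarith

end

/-! ### Signed weights that annihilate low-degree polynomials. -/

section

open Finset

lemma exists_int_of_mem_latticeNodes {N : ℕ} {z : ℝ} (hz : z ∈ latticeNodes N) :
    ∃ m : ℤ, z = m ∧ |z| ≤ N := by
  rw [latticeNodes, mem_image] at hz
  obtain ⟨j, hj, rfl⟩ := hz
  have h2 : (j : ℝ) ≤ 2 * N := by
    rw [mem_range] at hj; exact_mod_cast Nat.lt_succ_iff.1 hj
  have h3 : (0 : ℝ) ≤ j := j.cast_nonneg
  refine ⟨(j : ℤ) - N, by push_cast; rfl, ?_⟩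
  rw [abs_le]; constructor <;> linarith

lemma notMem_latticeNodes {N : ℕ} {z : ℝ} (h0 : 0 < z) (h1 : z < 1) : z ∉ latticeNodes N := by
  intro hz
  obtain ⟨m, rfl, -⟩ := exists_int_of_mem_latticeNodes hz
  have h2 : 0 < m := by exact_mod_cast h0
  have h3 : m < 1 := by exact_mod_cast h1
  omega

lemma zero_mem_latticeNodes (N : ℕ) : (0 : ℝ) ∈ latticeNodes N := by
  rw [latticeNodes, mem_image]
  exact ⟨N, by rw [mem_range]; omega, sub_self _⟩

lemma card_latticeNodes (N : ℕ) : #(latticeNodes N) = 2 * N + 1 := by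
  rw [latticeNodes, card_image_of_injective _ (latticeNode_injective N), card_range]

lemma factorial_sq_le_prod_latticeNodes_erase {N : ℕ} {y : ℝ} (hy : y ∈ latticeNodes N) :
    (N.factorial : ℝ) ^ 2 ≤ ∏ z ∈ (latticeNodes N).erase y, |y - z| := by
  rw [latticeNodes, mem_image] at hy
  obtain ⟨j, hj, rfl⟩ := hy
  have hj' : j ≤ 2 * N := by rw [mem_range] at hj; omega
  rw [prod_latticeNodes_erase hj']
  exact factorial_sq_le hj'

lemma prod_latticeNodes_erase_zero (N : ℕ) :
    ∏ z ∈ (latticeNodes N).erase 0, |0 - z| = (N.factorial : ℝ) ^ 2 := by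
  have h := prod_latticeNodes_erase (N := N) (i := N) (by omega)
  rw [sub_self, show 2 * N - N = N by omega] at h
  rw [h, pow_two]

/-- A signed measure of the form `δ₀ - δ_τ + O(τ)` that annihilates polynomials of low degree:
a divided difference at equispaced nodes and two additional nodes near the origin. -/
lemma exists_annihilating_weights {N : ℕ} (hN : 1 ≤ N) {τ : ℝ} (hτ : 0 < τ) (hτ' : τ ≤ 1 / 8) :
    ∃ (Y : Finset ℝ) (s : ℝ → ℝ), 0 ∈ Y ∧ τ ∈ Y ∧ (∀ y ∈ Y, |y| ≤ N) ∧ s 0 = 1 ∧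
      (∀ m < 2 * N, ∑ y ∈ Y, s y * y ^ m = 0) ∧ ∑ y ∈ (Y.erase 0).erase τ, |s y| ≤ 12 * τ := by
  set Z := latticeNodes N with hZ
  have hτZ : τ ∉ Z := notMem_latticeNodes hτ (by linarith)
  have hhZ : (1 / 2 : ℝ) ∉ Z := notMem_latticeNodes (by norm_num) (by norm_num)
  have hτh : τ ≠ 1 / 2 := by linarith
  -- The node `τ` makes `W 0` of order `τ (N!)²`. The node `1/2` adds a factor `|y|` to the lower
  -- bound on `W y`, so the weights decay like `τ / y²` and have a sum bounded independently of `N`.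
  set Y : Finset ℝ := insert τ (insert (1 / 2) Z) with hY
  set W : ℝ → ℝ := fun y => ∏ z ∈ Y.erase y, (y - z) with hW
  have h0Z : (0 : ℝ) ∈ Z := zero_mem_latticeNodes N
  have h0Y : (0 : ℝ) ∈ Y := mem_insert_of_mem (mem_insert_of_mem h0Z)
  have hWne : ∀ y, W y ≠ 0 := fun y => prod_ne_zero_iff.2 fun z hz =>
    sub_ne_zero.2 (ne_of_mem_erase hz).symm
  have hcard : #Y = 2 * N + 3 := by
    rw [hY, card_insert_of_notMem (by simp only [mem_insert, not_or]; exact ⟨hτh, hτZ⟩),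
      card_insert_of_notMem hhZ, card_latticeNodes]
  have hWZ : ∀ y ∈ Z, |W y| = |y - τ| * (|y - 1 / 2| * ∏ z ∈ Z.erase y, |y - z|) := by
    intro y hy
    have h1 : τ ≠ y := fun h => hτZ (h ▸ hy)
    have h2 : 1 / 2 ≠ y := fun h => hhZ (h ▸ hy)
    simp only [hW]
    rw [abs_prod, hY, erase_insert_of_ne h1, erase_insert_of_ne h2, prod_insert, prod_insert]
    · exact fun h => hhZ (mem_of_mem_erase h)
    · simp only [mem_insert, not_or]
      exact ⟨hτh, fun h => hτZ (mem_of_mem_erase h)⟩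
  have hW0 : |W 0| = τ / 2 * (N.factorial : ℝ) ^ 2 := by
    rw [hWZ 0 h0Z, prod_latticeNodes_erase_zero, zero_sub, zero_sub, abs_neg, abs_neg,
      abs_of_pos hτ, abs_of_pos (by norm_num : (0 : ℝ) < 1 / 2)]
    ring
  have hWh : |W (1 / 2)| = (1 / 2 - τ) * ∏ z ∈ Z, |1 / 2 - z| := by
    simp only [hW]
    rw [abs_prod, hY, erase_insert_of_ne hτh, erase_insert hhZ, prod_insert hτZ,
      abs_of_nonneg (by linarith : 0 ≤ 1 / 2 - τ)]
  have hfac : (0 : ℝ) < (N.factorial : ℝ) ^ 2 := by positivity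
  refine ⟨Y, fun y => W 0 / W y, h0Y, mem_insert_self _ _, ?_, div_self (hWne 0), ?_, ?_⟩
  · have hN1 : (1 : ℝ) ≤ N := by exact_mod_cast hN
    intro y hy
    rw [hY, mem_insert, mem_insert] at hy
    rcases hy with rfl | rfl | hy
    · rw [abs_of_pos hτ]; linarith
    · rw [abs_of_pos (by norm_num)]; linarith
    · exact (exists_int_of_mem_latticeNodes hy).choose_spec.2
  · intro m hm
    -- Lagrange interpolation expresses the coefficient of `X ^ (#Y - 1)` in `X ^ m` as `∑ y ^ m / W
    -- y`; it vanishes since `m < #Y - 1`.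
    have h := Lagrange.coeff_eq_sum (s := Y) (v := id) (P := (Polynomial.X ^ m : Polynomial ℝ))
      Function.injective_id.injOn (by
        rw [Polynomial.degree_X_pow, hcard]; exact_mod_cast (by omega : m < 2 * N + 3))
    rw [Polynomial.coeff_X_pow, if_neg (by omega)] at h
    simp only [Polynomial.eval_pow, Polynomial.eval_X, id] at h
    calc ∑ y ∈ Y, W 0 / W y * y ^ m = W 0 * ∑ y ∈ Y, y ^ m / W y := by
          rw [mul_sum]; exact sum_congr rfl fun y _ => by ring
      _ = 0 := by rw [← h, mul_zero]
  · have hset : (Y.erase 0).erase τ = insert (1 / 2) (Z.erase 0) := by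
      rw [erase_right_comm, hY, erase_insert (by
        simp only [mem_insert, not_or]; exact ⟨hτh, hτZ⟩), erase_insert_of_ne (by norm_num)]
    have hs : ∀ y ∈ Z.erase 0, |W 0 / W y| ≤ 8 / 7 * τ * (1 / y ^ 2) := by
      intro y hy
      have hyZ := mem_of_mem_erase hy
      have hy0 := ne_of_mem_erase hy
      rw [abs_div, hW0, hWZ y hyZ]
      obtain ⟨m, hm, -⟩ := exists_int_of_mem_latticeNodes hyZ
      have hm1 : 1 ≤ |y| := by
        have : m ≠ 0 := by rintro rfl; simp at hm; exact hy0 hm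
        rw [hm]; exact_mod_cast Int.one_le_abs this
      have h1 : 7 / 8 * |y| ≤ |y - τ| := by
        have := abs_sub_abs_le_abs_sub y τ
        rw [abs_of_pos hτ] at this
        linarith
      have h2 : 1 / 2 * |y| ≤ |y - 1 / 2| := by
        have := abs_sub_abs_le_abs_sub y (1 / 2)
        rw [abs_of_pos (by norm_num : (0 : ℝ) < 1 / 2)] at this
        linarith
      have h3 := factorial_sq_le_prod_latticeNodes_erase hyZ
      have hlow : 7 / 16 * y ^ 2 * (N.factorial : ℝ) ^ 2 ≤
          |y - τ| * (|y - 1 / 2| * ∏ z ∈ Z.erase y, |y - z|) := by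
        calc 7 / 16 * y ^ 2 * (N.factorial : ℝ) ^ 2 =
            7 / 8 * |y| * (1 / 2 * |y| * (N.factorial : ℝ) ^ 2) := by rw [← sq_abs y]; ring
          _ ≤ _ := by gcongr
      have hy2 : 0 < y ^ 2 := by positivity
      refine (div_le_div_of_nonneg_left (by positivity) (by positivity) hlow).trans (le_of_eq ?_)
      field_simp
      norm_num
    have hh : |W 0 / W (1 / 2)| ≤ 16 / 3 * τ := by
      have h1 := factorial_sq_le_prod_latticeNodes_half N
      have hlow : 3 / 8 * ((N.factorial : ℝ) ^ 2 / 4) ≤ |W (1 / 2)| := by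
        rw [hWh]
        exact mul_le_mul (by linarith) h1 (by positivity) (by linarith)
      rw [abs_div, hW0]
      refine (div_le_div_of_nonneg_left (by positivity) (by positivity) hlow).trans (le_of_eq ?_)
      field_simp
      norm_num
    rw [hset, sum_insert fun h => hhZ (mem_of_mem_erase h)]
    have h4 : ∑ y ∈ Z.erase 0, |W 0 / W y| ≤ 8 / 7 * τ * 4 := by
      refine (sum_le_sum hs).trans ?_
      rw [← mul_sum]
      refine mul_le_mul_of_nonneg_left ?_ (by positivity)
      refine le_trans (sum_le_sum_of_subset_of_nonneg (erase_subset _ _) fun y _ _ => by positivity)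
        (sum_latticeNodes_inv_sq_le N hN)
    linarith

/-- The annihilating weights, rescaled so that their exponential energy decays exponentially. -/
lemma exists_weights_energy_le {N : ℕ} (hN : 1 ≤ N) {τ : ℝ} (hτ : 0 < τ) (hτ' : τ ≤ 1 / 8) :
    ∃ (X : Finset ℝ) (s : ℝ → ℝ), 0 ∈ X ∧ τ / (2 * √N) ∈ X ∧ s 0 = 1 ∧ ∑ x ∈ X, s x = 0 ∧
      ∑ x ∈ (X.erase 0).erase (τ / (2 * √N)), |s x| ≤ 12 * τ ∧
      ∑ x ∈ X, ∑ y ∈ X, s x * s y * Real.exp (x * y) ≤ 225 * τ ^ 2 * Real.exp (-N) := by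
  obtain ⟨Y, s, h0, hτY, hYN, hs0, hmom, hsum⟩ := exists_annihilating_weights hN hτ hτ'
  have hN0 : (0 : ℝ) < N := by exact_mod_cast hN
  -- This scale puts the support in `|x| ≤ √N / 2`, where `2N` vanishing moments leave an energy
  -- factor `(N/4)^(2N) / (2N)! * exp (N/4) ≤ exp (-N)`.
  set h : ℝ := 1 / (2 * √N) with hh
  have hpos : 0 < h := by positivity
  have hinj : Function.Injective fun y : ℝ => h * y := mul_right_injective₀ hpos.ne'
  have hdiv : ∀ y, h * y / h = y := fun y => mul_div_cancel_left₀ y hpos.ne'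
  have hτh : τ / (2 * √N) = h * τ := by rw [hh]; ring
  have hsq : (h * N) ^ 2 = N / 4 := by
    rw [hh, mul_pow, div_pow, mul_pow, Real.sq_sqrt hN0.le]; field_simp; norm_num
  have hmom' : ∀ m < 2 * N, ∑ x ∈ Y.image (fun y => h * y), s (x / h) * x ^ m = 0 := by
    intro m hm
    rw [sum_image hinj.injOn]
    simp_rw [hdiv, mul_pow]
    have := congrArg (h ^ m * ·) (hmom m hm)
    simp only [mul_zero, mul_sum] at this
    rw [← this]
    exact sum_congr rfl fun y _ => by ring
  have hmass : ∑ y ∈ Y, s y = 0 := by simpa using hmom 0 (by omega)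
  refine ⟨Y.image fun y => h * y, fun x => s (x / h), ?_, ?_, ?_, ?_, ?_, ?_⟩
  · exact mem_image.2 ⟨0, h0, mul_zero h⟩
  · rw [hτh]; exact mem_image_of_mem _ hτY
  · simpa using hs0
  · simpa using hmom' 0 (by omega)
  · have h1 : ((Y.image fun y => h * y).erase 0).erase (h * τ) =
        ((Y.erase 0).erase τ).image fun y => h * y := by
      rw [image_erase hinj, image_erase hinj, mul_zero]
    rw [hτh, h1, sum_image hinj.injOn]
    simpa only [hdiv] using hsum
  · have hB : ∀ x ∈ Y.image (fun y => h * y), |x| ≤ h * N := by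
      intro x hx
      obtain ⟨y, hy, rfl⟩ := mem_image.1 hx
      rw [abs_mul, abs_of_pos hpos]
      exact mul_le_mul_of_nonneg_left (hYN y hy) hpos.le
    have h2 := sum_mul_exp_le_of_moments_eq_zero (by omega : 1 ≤ 2 * N) hB hmom'
    refine h2.trans ?_
    have hτ0 : τ ∈ Y.erase 0 := mem_erase.2 ⟨hτ.ne', hτY⟩
    have hsτ : |s τ| ≤ 1 + 12 * τ := by
      rw [← add_sum_erase _ _ h0, ← add_sum_erase _ _ hτ0, hs0] at hmass
      have h3 := abs_sum_le_sum_abs s ((Y.erase 0).erase τ)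
      have h4 : s τ = -1 - ∑ y ∈ (Y.erase 0).erase τ, s y := by linarith
      rw [h4]
      refine (abs_sub _ _).trans ?_
      rw [abs_neg, abs_one]
      linarith
    -- The atom at `0` drops out, the one at `h τ` gives at most `3τ`, and the remaining weights
    -- give `12τ`, in units of `h N`.
    have hfirst : ∑ x ∈ Y.image (fun y => h * y), |s (x / h)| * |x| ≤ 15 * τ * (h * N) := by
      rw [sum_image hinj.injOn]
      simp_rw [hdiv]
      rw [← add_sum_erase _ _ h0, ← add_sum_erase _ _ hτ0, mul_zero, abs_zero, mul_zero, zero_add,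
        abs_of_pos (mul_pos hpos hτ)]
      have h5 : ∑ y ∈ (Y.erase 0).erase τ, |s y| * |h * y| ≤ 12 * τ * (h * N) := by
        refine (sum_le_sum fun y hy => mul_le_mul_of_nonneg_left
          (hB (h * y) (mem_image_of_mem _ (mem_of_mem_erase (mem_of_mem_erase hy))))
          (abs_nonneg (s y))).trans ?_
        rw [← sum_mul]
        exact mul_le_mul_of_nonneg_right hsum (by positivity)
      have h6 : |s τ| * (h * τ) ≤ 3 * τ * (h * N) := by
        calc |s τ| * (h * τ) ≤ 3 * (h * τ) :=
              mul_le_mul_of_nonneg_right (by linarith) (by positivity)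
          _ = 3 * τ * (h * 1) := by ring
          _ ≤ _ := by gcongr; exact_mod_cast hN
      linarith
    have hfirst0 : 0 ≤ ∑ x ∈ Y.image (fun y => h * y), |s (x / h)| * |x| :=
      sum_nonneg fun x _ => by positivity
    calc _ ≤ (15 * τ * (h * N)) ^ 2 * (((h * N) ^ 2) ^ (2 * N - 1) * Real.exp ((h * N) ^ 2) /
          (2 * N).factorial) := by gcongr
      _ = 225 * τ ^ 2 * (((h * N) ^ 2 * ((h * N) ^ 2) ^ (2 * N - 1)) / (2 * N).factorial *
          Real.exp ((h * N) ^ 2)) := by ring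
      _ = 225 * τ ^ 2 * (((N : ℝ) / 4) ^ (2 * N) / (2 * N).factorial * Real.exp (N / 4)) := by
          rw [← pow_succ', Nat.sub_add_cancel (by omega), hsq]
      _ ≤ 225 * τ ^ 2 * Real.exp (-N) := by
          refine mul_le_mul_of_nonneg_left ?_ (by positivity)
          have h7 := Real.pow_div_factorial_le_exp (2 * N : ℝ) (by positivity) (2 * N)
          have h8 : ((N : ℝ) / 4) ^ (2 * N) / (2 * N).factorial =
              (1 / 64) ^ N * ((2 * N : ℝ) ^ (2 * N) / (2 * N).factorial) := by
            rw [show (N : ℝ) / 4 = 1 / 8 * (2 * N) by ring, mul_pow (1 / 8 : ℝ), pow_mul (1 / 8 : ℝ)]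
            norm_num
            ring
          rw [h8]
          calc _ ≤ (1 / 64) ^ N * Real.exp (2 * N) * Real.exp (N / 4) := by gcongr
            _ = (1 / 64 * Real.exp (2 + 1 / 4)) ^ N := by
                rw [mul_pow, ← Real.exp_nat_mul, mul_assoc, ← Real.exp_add]; congr 2; ring
            _ ≤ Real.exp (-1) ^ N := by
                gcongr
                have h9 : Real.exp (2 + 1 / 4) ≤ 64 * Real.exp (-1) := by
                  have h10 : Real.exp 4 ≤ 64 := by
                    have := Real.exp_one_lt_d9
                    rw [show (4 : ℝ) = ((4 : ℕ) : ℝ) * 1 by norm_num, Real.exp_nat_mul]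
                    calc Real.exp 1 ^ 4 ≤ 2.8 ^ 4 := by gcongr; linarith
                      _ ≤ 64 := by norm_num
                  calc Real.exp (2 + 1 / 4) ≤ Real.exp (4 + -1) :=
                        Real.exp_le_exp.2 (by norm_num)
                    _ = Real.exp 4 * Real.exp (-1) := Real.exp_add _ _
                    _ ≤ _ := by gcongr
                linarith
            _ = Real.exp (-N) := by rw [← Real.exp_nat_mul]; congr 1; ring

end

/-! ### From signed weights to mixing distributions. -/

/-- Two mixing distributions with an atom of mass at least `1 - ε` at `0` and at a distant point,
whose Gaussian mixtures nearly coincide. -/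
lemma exists_mixing_distributions {N : ℕ} (hN : 1 ≤ N) {ε : ℝ} (hε : 0 < ε) (hε' : ε < 1 / 2) :
    ∃ (X : Finset ℝ) (p₀ p₁ : ℝ → ℝ), (∀ x ∈ X, 0 ≤ p₀ x) ∧ (∀ x ∈ X, 0 ≤ p₁ x) ∧
      ∑ x ∈ X, p₀ x = 1 ∧ ∑ x ∈ X, p₁ x = 1 ∧ 0 ∈ X ∧ ε / 1000 / (2 * √N) ∈ X ∧
      1 - ε ≤ p₀ 0 ∧ 1 - ε ≤ p₁ (ε / 1000 / (2 * √N)) ∧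
      ∑ x ∈ X, ∑ y ∈ X, (p₀ x - p₁ x) * (p₀ y - p₁ y) * Real.exp (x * y) ≤
        16 * (1 - 2 * ε) ^ 2 * (225 * (ε / 1000) ^ 2 * Real.exp (-N)) := by
  obtain ⟨X, s, h0, hd, hs0, hmass, hrest, hen⟩ := exists_weights_energy_le hN
    (show 0 < ε / 1000 by positivity) (by linarith)
  have hN0 : (0 : ℝ) < N := by exact_mod_cast hN
  set d := ε / 1000 / (2 * √N) with hddef
  have hd0 : d ≠ 0 := by positivity
  have hdX : d ∈ X.erase 0 := Finset.mem_erase.2 ⟨hd0, hd⟩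
  set R := ∑ x ∈ (X.erase 0).erase d, |s x| with hR
  have hR2 : R ≤ ε / 2 := by linarith
  have hsd : |s d + 1| ≤ R := by
    have h1 : s d + 1 = -∑ x ∈ (X.erase 0).erase d, s x := by
      rw [← Finset.add_sum_erase _ _ h0, ← Finset.add_sum_erase _ _ hdX, hs0] at hmass
      linarith
    rw [h1, abs_neg]
    exact Finset.abs_sum_le_sum_abs _ _
  obtain ⟨hsd1, hsd2⟩ := abs_le.1 hsd
  set T := ∑ x ∈ X, max (s x) 0 with hT
  have hT' : ∑ x ∈ X, max (-s x) 0 = T := by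
    have h1 : ∑ x ∈ X, max (-s x) 0 + ∑ x ∈ X, s x = T := by
      rw [hT, ← Finset.sum_add_distrib]
      refine Finset.sum_congr rfl fun x _ => ?_
      rcases le_total (s x) 0 with h | h
      · rw [max_eq_left (by linarith : 0 ≤ -s x), max_eq_right h]; ring
      · rw [max_eq_right (by linarith : -s x ≤ 0), max_eq_left h]; ring
    rwa [hmass, add_zero] at h1
  have hTle : T ≤ 1 + ε / 2 := by
    have h1 : T + T = ∑ x ∈ X, |s x| := by
      nth_rewrite 2 [← hT']
      rw [hT, ← Finset.sum_add_distrib]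
      refine Finset.sum_congr rfl fun x _ => ?_
      rcases le_total (s x) 0 with h | h
      · rw [max_eq_left (by linarith : 0 ≤ -s x), max_eq_right h, abs_of_nonpos h]; ring
      · rw [max_eq_right (by linarith : -s x ≤ 0), max_eq_left h, abs_of_nonneg h]; ring
    rw [← Finset.add_sum_erase _ _ h0, ← Finset.add_sum_erase _ _ hdX, hs0, abs_one] at h1
    have h2 : |s d| ≤ 1 + R := abs_le.2 ⟨by linarith, by linarith⟩
    linarith
  -- With the leftover mass `1 - ρ T` shared equally between `0` and `d`, each main atom has mass at
  -- least `1/2 + ρ (1 - 3ε/2) / 2`. This `ρ` makes that exactly `1 - ε`.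
  set ρ := (1 - 2 * ε) / (1 - 3 / 2 * ε) with hρ
  have hden : 0 < 1 - 3 / 2 * ε := by linarith
  have hρ0 : 0 ≤ ρ := div_nonneg (by linarith) hden.le
  have hρ1 : ρ * (1 - 3 / 2 * ε) = 1 - 2 * ε := div_mul_cancel₀ _ hden.ne'
  have hρ4 : ρ ≤ 4 * (1 - 2 * ε) := by
    rw [hρ, div_le_iff₀ hden]; nlinarith
  have hρT : ρ * T ≤ 1 := by
    have h1 : ρ * (1 + ε / 2) ≤ 1 := by
      rw [hρ, div_mul_eq_mul_div, div_le_one hden]; nlinarith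
    exact (mul_le_mul_of_nonneg_left hTle hρ0).trans h1
  set b := (1 - ρ * T) / 2 with hb
  have hb0 : 0 ≤ b := by rw [hb]; linarith
  have hbase0 : ∀ x, 0 ≤ (if x = 0 then b else 0) + if x = d then b else 0 := fun x => by
    split_ifs <;> linarith
  have hbsum : ∑ x ∈ X, ((if x = 0 then b else 0) + if x = d then b else 0) = 1 - ρ * T := by
    rw [Finset.sum_add_distrib, Finset.sum_ite_eq', Finset.sum_ite_eq', if_pos h0, if_pos hd, hb]
    ring
  have hbge : 1 - ε ≤ ρ * (1 - ε / 2) + b := by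
    have h1 : ρ * T ≤ ρ * (1 + ε / 2) := mul_le_mul_of_nonneg_left hTle hρ0
    rw [hb]; linarith
  refine ⟨X, fun x => ρ * max (s x) 0 + ((if x = 0 then b else 0) + if x = d then b else 0),
    fun x => ρ * max (-s x) 0 + ((if x = 0 then b else 0) + if x = d then b else 0),
    fun x _ => add_nonneg (mul_nonneg hρ0 (le_max_right _ _)) (hbase0 x),
    fun x _ => add_nonneg (mul_nonneg hρ0 (le_max_right _ _)) (hbase0 x), ?_, ?_, h0, hd, ?_, ?_, ?_⟩
  · rw [Finset.sum_add_distrib, hbsum, ← Finset.mul_sum, ← hT]; ring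
  · rw [Finset.sum_add_distrib, hbsum, ← Finset.mul_sum, hT']; ring
  · dsimp only
    rw [if_pos rfl, if_neg hd0.symm, hs0, max_eq_left zero_le_one, add_zero]
    refine hbge.trans ?_
    have : ρ * (1 - ε / 2) ≤ ρ * 1 := mul_le_mul_of_nonneg_left (by linarith) hρ0
    linarith
  · dsimp only
    rw [if_neg hd0, if_pos rfl, zero_add]
    refine hbge.trans ?_
    have : ρ * (1 - ε / 2) ≤ ρ * max (-s d) 0 :=
      mul_le_mul_of_nonneg_left (le_max_of_le_left (by linarith)) hρ0
    linarith
  · have hdiff : ∀ x, ρ * max (s x) 0 + ((if x = 0 then b else 0) + if x = d then b else 0) -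
        (ρ * max (-s x) 0 + ((if x = 0 then b else 0) + if x = d then b else 0)) = ρ * s x := by
      intro x
      rw [add_sub_add_right_eq_sub, ← mul_sub]
      rcases le_total (s x) 0 with h | h
      · rw [max_eq_left (by linarith : 0 ≤ -s x), max_eq_right h]; ring
      · rw [max_eq_right (by linarith : -s x ≤ 0), max_eq_left h]; ring
    simp_rw [hdiff]
    have h1 : ∑ x ∈ X, ∑ y ∈ X, ρ * s x * (ρ * s y) * Real.exp (x * y) =
        ρ ^ 2 * ∑ x ∈ X, ∑ y ∈ X, s x * s y * Real.exp (x * y) := by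
      simp_rw [Finset.mul_sum]
      exact Finset.sum_congr rfl fun x _ => Finset.sum_congr rfl fun y _ => by ring
    rw [h1]
    have h2 : ρ ^ 2 ≤ 16 * (1 - 2 * ε) ^ 2 := by
      calc ρ ^ 2 ≤ (4 * (1 - 2 * ε)) ^ 2 := pow_le_pow_left₀ hρ0 hρ4 2
        _ = _ := by ring
    exact (mul_le_mul_of_nonneg_left hen (sq_nonneg ρ)).trans
      (mul_le_mul_of_nonneg_right h2 (by positivity))

/-! ### Choice of parameters in the two regimes of `k`. -/

lemma Real.exp_neg_four_le : Real.exp (-4) ≤ 1 / 20 := by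
  rw [Real.exp_neg, one_div]
  refine inv_anti₀ (by norm_num) ?_
  have := Real.exp_one_gt_d9
  rw [show (4 : ℝ) = ((4 : ℕ) : ℝ) * 1 by norm_num, Real.exp_nat_mul]
  calc (20 : ℝ) ≤ 2.7 ^ 4 := by norm_num
    _ ≤ _ := by gcongr; linarith

lemma Real.rpow_neg_half_le {L D : ℝ} (hD : 0 < D) (h : 1 / D ^ 2 ≤ L) :
    L ^ (-(1 / 2) : ℝ) ≤ D := by
  have hL : 0 < L := lt_of_lt_of_le (by positivity) h
  rw [Real.rpow_neg hL.le, ← Real.sqrt_eq_rpow, inv_le_comm₀ (Real.sqrt_pos.2 hL) hD]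
  refine Real.le_sqrt_of_sq_le ?_
  rwa [inv_pow, ← one_div]

lemma Real.div_one_add_le_log_one_add {x : ℝ} (hx : 0 ≤ x) : x / (1 + x) ≤ Real.log (1 + x) := by
  refine le_trans (le_of_eq ?_) (Real.one_sub_inv_le_log_of_pos (by linarith : 0 < 1 + x))
  field_simp; ring

/-- Here `n - 2k ≥ n / 64`, so `a` is comparable to `k² / n` and bounded. Hence `log (1 + a)` is at
least of order `k² / n`, and the claimed rate is `O(1 / √n)`, the separation at which two
uncontaminated Gaussian samples are already indistinguishable. -/
lemma minimax_lower_bound_of_few_contaminations {n k : ℕ} (hk : 1 ≤ k)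
    (hkn : (k : ℝ) ≤ (n : ℝ) / 2 - √n) (hsmall : (k : ℝ) ≤ 32 * √n)
    {est : (Fin n → ℝ) → ℝ} (hest : Measurable est) :
    ENNReal.ofReal (1 / 10) ≤ ⨆ (θ : ℝ) (γ : Fin n → ℝ) (_ : hammingNorm γ ≤ k),
      modelLaw θ γ 1 {x | 1 / 30000 * ((k : ℝ) / n *
        Real.log (1 + (k : ℝ) ^ 2 * ((n : ℝ) - 2 * k) ^ 2 / (n : ℝ) ^ 3) ^ (-(1 / 2) : ℝ))
          < |est x - θ|} := by
  have hk1 : (1 : ℝ) ≤ k := by exact_mod_cast hk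
  have hsn := Real.sqrt_nonneg (n : ℝ)
  have hn0 : (0 : ℝ) < n := by linarith
  have hr : 0 < √(n : ℝ) := Real.sqrt_pos.2 hn0
  have hrr : √(n : ℝ) * √n = n := Real.mul_self_sqrt hn0.le
  have hm : 2 * √(n : ℝ) ≤ n - 2 * k := by linarith
  have hm64 : (n : ℝ) ≤ 64 * (n - 2 * k) := by
    rcases le_total (4 * (k : ℝ)) n with h | h
    · linarith
    · nlinarith
  have hn1 : (1 : ℝ) ≤ n := by linarith
  set d := 1 / (5 * √(n : ℝ)) with hd
  have hd0 : 0 < d := by positivity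
  have hd2 : d ^ 2 = 1 / (25 * n) := by rw [hd, div_pow, mul_pow, Real.sq_sqrt hn0.le]; norm_num
  refine minimax_lower_bound_of_mixtures (X := {0, d}) (p₀ := fun x => if x = 0 then 1 else 0)
    (p₁ := fun x => if x = d then 1 else 0) (d := d) (e := 0) (v := 4)
    (fun x _ => by split_ifs <;> norm_num)
    (fun x _ => by split_ifs <;> norm_num) ?_ ?_ (by simp) (by simp) (by simp) (by simp) (by norm_num) (by norm_num) ?_ ?_ ?_ hest
  · rw [Finset.sum_ite_eq', if_pos (by simp)]
  · rw [Finset.sum_ite_eq', if_pos (by simp)]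
  · refine le_trans (Real.exp_le_exp.2 ?_) Real.exp_neg_four_le
    linarith
  · rw [Finset.sum_pair hd0.ne, Finset.sum_pair hd0.ne, Finset.sum_pair hd0.ne]
    simp only [if_true, if_neg hd0.ne, if_neg hd0.ne', mul_zero, zero_mul, Real.exp_zero]
    rw [← pow_two d]
    have h25 : d ^ 2 ≤ 1 := by
      rw [hd2, div_le_one (by positivity)]; linarith
    have h1 := Real.abs_exp_sub_one_le (x := d ^ 2) (by rwa [abs_of_pos (by positivity)])
    rw [abs_of_pos (by positivity : 0 < d ^ 2)] at h1
    have h2 := (le_abs_self _).trans h1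
    have h3 : n * d ^ 2 = 1 / 25 := by rw [hd2]; field_simp
    calc _ = n * (Real.exp (d ^ 2) - 1) := by ring
      _ ≤ n * (2 * d ^ 2) := by gcongr
      _ = 2 * (n * d ^ 2) := by ring
      _ ≤ 1 / 10 := by rw [h3]; norm_num
  · set a := (k : ℝ) ^ 2 * ((n : ℝ) - 2 * k) ^ 2 / (n : ℝ) ^ 3 with ha
    have ha0 : 0 ≤ a := by positivity
    have hak : a ≤ 1024 := by
      rw [ha, div_le_iff₀ (by positivity)]
      have h1 : (k : ℝ) ^ 2 ≤ 1024 * n := by nlinarith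
      have h2 : ((n : ℝ) - 2 * k) ^ 2 ≤ n ^ 2 := by
        refine pow_le_pow_left₀ ?_ ?_ 2 <;> linarith
      calc (k : ℝ) ^ 2 * ((n : ℝ) - 2 * k) ^ 2 ≤ 1024 * n * n ^ 2 := by gcongr
        _ = _ := by ring
    have hal : (k : ℝ) ^ 2 / n / 4096 ≤ a := by
      have h2 : (n : ℝ) ^ 2 ≤ 4096 * (n - 2 * k) ^ 2 := by
        calc (n : ℝ) ^ 2 ≤ (64 * (n - 2 * k)) ^ 2 := pow_le_pow_left₀ hn0.le hm64 2
          _ = _ := by ring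
      rw [ha, div_div, div_le_div_iff₀ (by positivity) (by positivity)]
      calc (k : ℝ) ^ 2 * (n : ℝ) ^ 3 = (k : ℝ) ^ 2 * n * (n : ℝ) ^ 2 := by ring
        _ ≤ (k : ℝ) ^ 2 * n * (4096 * (n - 2 * k) ^ 2) := by gcongr
        _ = _ := by ring
    -- `2112² = 4096 * 33²`: the factor `4096` comes from `hal`, and `33² ≥ 1 + 1024` covers `1 +
    -- a`.
    have hL : Real.log (1 + a) ^ (-(1 / 2) : ℝ) ≤ 2112 * √n / k := by
      refine Real.rpow_neg_half_le (by positivity) ?_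
      refine le_trans ?_ (Real.div_one_add_le_log_one_add ha0)
      have h1 : 1 / (2112 * √(n : ℝ) / k) ^ 2 = (k : ℝ) ^ 2 / n / 4460544 := by
        rw [div_pow, mul_pow, Real.sq_sqrt hn0.le]; field_simp; norm_num
      have h2 : 0 ≤ (k : ℝ) ^ 2 / n := by positivity
      rw [h1, le_div_iff₀ (by positivity)]
      nlinarith
    have h3 : (k : ℝ) / n * Real.log (1 + a) ^ (-(1 / 2) : ℝ) ≤ 2112 / √n := by
      calc (k : ℝ) / n * Real.log (1 + a) ^ (-(1 / 2) : ℝ) ≤ k / n * (2112 * √n / k) := by gcongr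
        _ = 2112 * √n / (√n * √n) := by rw [hrr]; field_simp
        _ = _ := by field_simp
    have h4 : d = 1 / 5 * (1 / √n) := by rw [hd]; field_simp
    have h5 : 2112 / √(n : ℝ) = 2112 * (1 / √n) := by ring
    have h6 : 0 < 1 / √(n : ℝ) := by positivity
    rw [h4]
    rw [h5] at h3
    linarith

lemma minimax_lower_bound_of_many_contaminations {n k : ℕ}
    (hkn : (k : ℝ) ≤ (n : ℝ) / 2 - √n) (hlarge : 32 * √n < (k : ℝ))
    {est : (Fin n → ℝ) → ℝ} (hest : Measurable est) :
    ENNReal.ofReal (1 / 10) ≤ ⨆ (θ : ℝ) (γ : Fin n → ℝ) (_ : hammingNorm γ ≤ k),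
      modelLaw θ γ 1 {x | 1 / 30000 * ((k : ℝ) / n *
        Real.log (1 + (k : ℝ) ^ 2 * ((n : ℝ) - 2 * k) ^ 2 / (n : ℝ) ^ 3) ^ (-(1 / 2) : ℝ))
          < |est x - θ|} := by
  have hsn := Real.sqrt_nonneg (n : ℝ)
  have hk0 : (0 : ℝ) < k := by linarith
  have hn0 : (0 : ℝ) < n := by linarith
  have hr : 0 < √(n : ℝ) := Real.sqrt_pos.2 hn0
  have hrr : √(n : ℝ) * √n = n := Real.mul_self_sqrt hn0.le
  have hm : 2 * √(n : ℝ) ≤ n - 2 * k := by linarith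
  have hr2 : 2 ≤ √(n : ℝ) := by nlinarith
  have hq0 : 0 < √(k : ℝ) := Real.sqrt_pos.2 hk0
  have hqq : √(k : ℝ) * √k = k := Real.mul_self_sqrt hk0.le
  have hq8 : 8 ≤ √(k : ℝ) := Real.le_sqrt_of_sq_le (by linarith)
  have hqr : √(k : ℝ) ≤ √n := Real.sqrt_le_sqrt (by linarith)
  set a := (k : ℝ) ^ 2 * ((n : ℝ) - 2 * k) ^ 2 / (n : ℝ) ^ 3 with ha
  -- Keeps `L` away from `0`, so that rounding it up to an integer costs only a constant factor.
  have ha4 : 1 / 4 ≤ a := by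
    rw [ha, div_le_div_iff₀ (by norm_num) (by positivity)]
    rcases le_total (n : ℝ) (4 * k) with h | h
    · have h1 : 4 * (n : ℝ) ≤ (n - 2 * k) ^ 2 := by nlinarith
      have h2 : (n : ℝ) ^ 2 ≤ 16 * k ^ 2 := by nlinarith
      nlinarith [mul_le_mul h1 h2 (by positivity) (by positivity)]
    · have h1 : (n : ℝ) ^ 2 ≤ 4 * (n - 2 * k) ^ 2 := by nlinarith
      have h2 : 1024 * (n : ℝ) ≤ k ^ 2 := by nlinarith
      nlinarith [mul_le_mul h1 h2 (by positivity) (by positivity),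
        pow_pos hn0 3]
  set L := Real.log (1 + a) with hLdef
  have hL : 1 / 5 ≤ L := by
    refine le_trans ?_ (Real.div_one_add_le_log_one_add (by linarith : 0 ≤ a))
    rw [le_div_iff₀ (by linarith)]; linarith
  set N := ⌈L⌉₊ with hN
  have hN1 : 1 ≤ N := Nat.one_le_iff_ne_zero.2 (Nat.ceil_pos.2 (by linarith)).ne'
  have hLN : L ≤ N := Nat.le_ceil L
  have hNL : (N : ℝ) ≤ 6 * L := by
    have := Nat.ceil_lt_add_one (by linarith : 0 ≤ L)
    linarith
  have hN0 : (0 : ℝ) < N := by exact_mod_cast hN1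
  -- The expected number `n ε` of contaminations is `4 √k` below `k`. With `v = 2 / √k` the Chernoff
  -- exponent is then at most `4 - 8 = -4`.
  set ε := (k - 4 * √(k : ℝ)) / n with hε
  have hnε : n * ε = k - 4 * √(k : ℝ) := by rw [hε]; field_simp
  have hεlow : (k : ℝ) / n ≤ 2 * ε := by
    rw [div_le_iff₀ hn0]; nlinarith
  have hεpos : 0 < ε := by
    have : 0 < (k : ℝ) / n := by positivity
    linarith
  have hεup : ε ≤ k / n := by rw [hε]; gcongr; linarith
  have hε2 : n * (1 - 2 * ε) = n - 2 * k + 8 * √(k : ℝ) := by linarith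
  have hgap0 : 0 < 1 - 2 * ε := by
    have : 0 < n * (1 - 2 * ε) := by rw [hε2]; linarith
    exact pos_of_mul_pos_right this hn0.le
  -- The margin costs `8 √k ≤ 8 √n ≤ 4 (n - 2k)`; this is where `k ≤ n/2 - √n` keeps the gap `1 -
  -- 2ε` of order `(n - 2k) / n`.
  have hgap : 1 - 2 * ε ≤ 5 * (n - 2 * k) / n := by
    rw [le_div_iff₀ hn0]; linarith
  obtain ⟨X, p₀, p₁, hp₀, hp₁, hs₀, hs₁, h0, hd, he₀, he₁, hen⟩ :=
    exists_mixing_distributions hN1 hεpos (by linarith)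
  refine minimax_lower_bound_of_mixtures hp₀ hp₁ hs₀ hs₁ h0 hd he₀ he₁ (by linarith)
    (v := 2 / √(k : ℝ)) (by positivity) ?_ ?_ ?_ hest
  · refine le_trans (Real.exp_le_exp.2 ?_) Real.exp_neg_four_le
    set v := 2 / √(k : ℝ) with hv
    have hv0 : 0 < v := by positivity
    have hqv : √(k : ℝ) * v = 2 := by rw [hv]; field_simp
    have hv1 : v ≤ 1 := by rw [hv, div_le_one hq0]; linarith
    have h1 := Real.abs_exp_sub_one_sub_id_le (x := v) (by rwa [abs_of_pos hv0])
    have h2 : Real.exp v - 1 ≤ v + v ^ 2 := by linarith [(le_abs_self _).trans h1]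
    have h3 : (k : ℝ) * v ^ 2 = 4 := by
      calc (k : ℝ) * v ^ 2 = (√k * v) ^ 2 := by rw [mul_pow, Real.sq_sqrt hk0.le]
        _ = 4 := by rw [hqv]; norm_num
    have h4 : n * ε * (Real.exp v - 1) ≤ n * ε * (v + v ^ 2) :=
      mul_le_mul_of_nonneg_left h2 (by positivity)
    have h5 : 0 ≤ √(k : ℝ) * v ^ 2 := by positivity
    have h6 : (k - 4 * √(k : ℝ)) * (v + v ^ 2) =
        k * v + k * v ^ 2 - 4 * (√k * v) - 4 * (√k * v ^ 2) := by ring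
    rw [hnε, h6, h3, hqv] at h4
    rw [hnε]
    linarith
  -- Since `N ≥ log (1 + a)`, the factor `exp (-N)` cancels the growth of `n (1 - 2ε)² ε² ≤ 25 a`.
  · have h1 : Real.exp (-N) ≤ 1 / (1 + a) := by
      calc Real.exp (-N) ≤ Real.exp (-L) := Real.exp_le_exp.2 (by linarith)
        _ = 1 / (1 + a) := by rw [Real.exp_neg, hLdef, Real.exp_log (by linarith), one_div]
    have h2 : n * ((1 - 2 * ε) ^ 2 * ε ^ 2) ≤ 25 * a := by
      calc n * ((1 - 2 * ε) ^ 2 * ε ^ 2) ≤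
          n * ((5 * (n - 2 * k) / n) ^ 2 * (k / n) ^ 2) := by gcongr
        _ = 25 * a := by rw [ha]; field_simp; ring
    calc _ ≤ n * (16 * (1 - 2 * ε) ^ 2 * (225 * (ε / 1000) ^ 2 * Real.exp (-N))) := by gcongr
      _ = 9 / 2500 * (n * ((1 - 2 * ε) ^ 2 * ε ^ 2)) * Real.exp (-N) := by ring
      _ ≤ 9 / 2500 * (25 * a) * (1 / (1 + a)) := by gcongr
      _ = 9 / 100 * (a / (1 + a)) := by ring
      _ ≤ 9 / 100 * 1 := by gcongr; rw [div_le_one (by linarith)]; linarith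
      _ ≤ 1 / 10 := by norm_num
  · have hLh : L ^ (-(1 / 2) : ℝ) ≤ 5 / 2 / √N := by
      refine Real.rpow_neg_half_le (by positivity) ?_
      rw [div_pow, Real.sq_sqrt hN0.le, one_div_div, div_le_iff₀ (by norm_num)]
      linarith
    have hNs : 0 < 1 / √(N : ℝ) := by positivity
    calc 2 * (1 / 30000 * ((k : ℝ) / n * L ^ (-(1 / 2) : ℝ))) ≤
        2 * (1 / 30000 * (2 * ε * (5 / 2 / √N))) := by gcongr
      _ = ε / 3000 * (1 / √N) := by ring
      _ < ε / 2000 * (1 / √N) := by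
          refine mul_lt_mul_of_pos_right ?_ hNs
          linarith
      _ = _ := by field_simp; norm_num

theorem mainTheorem1 :
    ∃ C : ℝ, 0 < C ∧ ∃ c : ℝ, 0 < c ∧ ∀ n k : ℕ, 1 ≤ k → (k : ℝ) ≤ (n : ℝ) / 2 - √(n : ℝ) →
      ENNReal.ofReal c ≤
        ⨅ (est : (Fin n → ℝ) → ℝ) (_ : Measurable est),
          ⨆ (θ : ℝ) (γ : Fin n → ℝ) (_ : hammingNorm γ ≤ k),
            modelLaw θ γ 1
              {x | C * ((k : ℝ) / n *
                  Real.log (1 + (k : ℝ) ^ 2 * ((n : ℝ) - 2 * k) ^ 2 / (n : ℝ) ^ 3) ^ (-(1 / 2) : ℝ))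
                < |est x - θ|} := by
  refine ⟨1 / 30000, by norm_num, 1 / 10, by norm_num, fun n k hk hkn => ?_⟩
  refine le_iInf₂ fun est hest => ?_
  rcases le_or_gt (k : ℝ) (32 * √n) with h | h
  · exact minimax_lower_bound_of_few_contaminations hk hkn h hest
  · exact minimax_lower_bound_of_many_contaminations hkn h hest
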